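/- All manifolds are smooth, Hausdorff, second countable, connected and without boundary; vector fields and sections are smooth, $\Gamma(\cdot)$ denotes smooth sections, and $2\,d\eta(V,W)=V(\eta(W))-W(\eta(V))-\eta([V,W])$. Let $(M^{2n+1},\phi,\xi,\eta,g)$ be a contact metric manifold: $\eta$ is a $1$-form with $\eta\wedge(d\eta)^n\neq 0$ everywhere, $\xi$ is its Reeb vector field ($\eta(\xi)=1$, $d\eta(\xi,\cdot)=0$), $g$ is a Riemannian metric and $\phi$ a $(1,1)$-tensor field with $g(V,\xi)=\eta(V)$, $\phi^2=-I+\eta\otimes\xi$ and $d\eta(V,W)=g(V,\phi W)$. Put $h=\tfrac12\mathcal L_\xi\phi$. Let $L$ be a Legendrian distribution, i.e. a rank-$n$ subbundle of $\ker\eta$ with $d\eta(X,X')=0$ for all $X,X'\in\Gamma(L)$, and let $Q:=\phi L$, so that $TM=L\oplus Q\oplus\mathbb R\xi$; write $V_L$, $V_Q$ for the components of $V$ in $L$ and $Q$. Let $\nabla$ be the bi-Legendrian connection of $(L,Q)$, i.e. the unique linear connection with torsion $T$ such that * $\nabla L\subset L$, $\nabla Q\subset Q$, $\nabla\xi=0$;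 * $\nabla d\eta=0$; * $T(X,Y)=2\,d\eta(X,Y)\,\xi$ for all $X\in\Gamma(L)$, $Y\in\Gamma(Q)$, and $T(V,\xi)=[\xi,V_L]_Q+[\xi,V_Q]_L$ for all $V\in\Gamma(TM)$. Then the following four conditions are equivalent: 1. $\nabla g=0$; 2. $\nabla\phi=0$; 3. $\nabla_XX'=-(\phi[X,\phi X'])_L$ for all $X,X'\in\Gamma(L)$, $\nabla_YY'=-(\phi[Y,\phi Y'])_Q$ for all $Y,Y'\in\Gamma(Q)$, and $h$ maps $L$ into $L$ and $Q$ into $Q$; 4. $g$ is bundle-like with respect to both $L\oplus\mathbb R\xi$ and $Q\oplus\mathbb R\xi$, where $g$ is called bundle-like with respect to a distribution $F$ if $(\mathcal L_Vg)(Z,Z')=0$ for all $V\in\Gamma(F)$ and all $Z,Z'\in\Gamma(F^\perp)$. Moreover, if $L$ and $Q$ are integrable (closed under the Lie bracket), then conditions 1–4 are also equivalent to both foliations being totally geodesic, i.e. $\hat\nabla_XX'\in\Gamma(L)$ for all $X,X'\in\Gamma(L)$ and $\hat\nabla_YY'\in\Gamma(Q)$ for all $Y,Y'\in\Gamma(Q)$,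 where $\hat\nabla$ is the Levi-Civita connection of $g$. -/

import Mathlib

open Bundle
open scoped Manifold ContDiff Topology

noncomputable section

namespace BiLegendrian

variable {E : Type*} [NormedAddCommGroup E] [NormedSpace ℝ E]
  {H : Type*} [TopologicalSpace H] (I : ModelWithCorners ℝ E H)
  {M : Type*} [TopologicalSpace M] [ChartedSpace H M]

/-! ### Vector fields, one-forms and tensor fields -/

/-- `V ∈ Γ(TM)`: the (global) vector field `V` is smooth. -/
def IsVectorField [IsManifold I ∞ M] (V : Π x : M, TangentSpace I x) : Prop :=
  ContMDiff I I.tangent ∞ (fun x ↦ (⟨x, V x⟩ : TangentBundle I M))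

/-- `η` is a smooth one-form. -/
def IsSmoothOneForm [IsManifold I ∞ M] (η : Π x : M, TangentSpace I x →L[ℝ] ℝ) : Prop :=
  ContMDiff I (I.prod 𝓘(ℝ, E →L[ℝ] ℝ)) ∞
    (fun x ↦ TotalSpace.mk' (E →L[ℝ] ℝ)
      (E := fun x : M ↦ TangentSpace I x →L[ℝ] ℝ) x (η x))

/-- `φ` is a smooth tensor field of type `(1,1)`. -/
def IsSmoothEndo [IsManifold I ∞ M]
    (φ : Π x : M, TangentSpace I x →L[ℝ] TangentSpace I x) : Prop :=
  ContMDiff I (I.prod 𝓘(ℝ, E →L[ℝ] E)) ∞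
    (fun x ↦ TotalSpace.mk' (E →L[ℝ] E)
      (E := fun x : M ↦ TangentSpace I x →L[ℝ] TangentSpace I x) x (φ x))

/-- The derivative `V(f)` of the function `f` along the vector field `V`. -/
def dirDeriv (V : Π x : M, TangentSpace I x) (f : M → ℝ) (x : M) : ℝ :=
  mvfderiv I f x (V x)

/-- The vector field `φ V`. -/
def app {I : ModelWithCorners ℝ E H} (φ : Π x : M, TangentSpace I x →L[ℝ] TangentSpace I x)
    (V : Π x : M, TangentSpace I x) : Π x : M, TangentSpace I x :=
  fun x ↦ φ x (V x)

/-- The exterior derivative of a one-form, evaluated on smooth vector fields, with the convention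
`2 dη(V, W) = V(η(W)) - W(η(V)) - η([V, W])`. -/
def dForm (η : Π x : M, TangentSpace I x →L[ℝ] ℝ) (V W : Π x : M, TangentSpace I x) (x : M) : ℝ :=
  (1 / 2 : ℝ) * (dirDeriv I V (fun y ↦ η y (W y)) x - dirDeriv I W (fun y ↦ η y (V y)) x
    - η x (VectorField.mlieBracket I V W x))

/-- The value of `η ∧ (dη)^n` on the vector fields `V 0, …, V (2n)` at `x`, up to a positive
constant depending only on `n` and on the normalization of the wedge product. -/
def wedgePow (n : ℕ) (η : Π x : M, TangentSpace I x →L[ℝ] ℝ)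
    (V : Fin (2 * n + 1) → Π x : M, TangentSpace I x) (x : M) : ℝ :=
  ∑ σ : Equiv.Perm (Fin (2 * n + 1)), ((Equiv.Perm.sign σ : ℤ) : ℝ) *
    (η x (V (σ 0) x) *
      ∏ i : Fin n, dForm I η (V (σ ⟨2 * (i : ℕ) + 1, by omega⟩))
        (V (σ ⟨2 * (i : ℕ) + 2, by omega⟩)) x)

/-! ### Contact manifolds and contact metric structures -/

/-- `η` is a contact form: a smooth one-form on a `(2n+1)`-dimensional manifold
with `η ∧ (dη)^n ≠ 0` everywhere. -/
structure IsContactForm [IsManifold I ∞ M] (n : ℕ)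
    (η : Π x : M, TangentSpace I x →L[ℝ] ℝ) : Prop where
  finrank_eq : Module.finrank ℝ E = 2 * n + 1
  smooth : IsSmoothOneForm I η
  wedge_ne_zero : ∀ x, ∃ V : Fin (2 * n + 1) → Π x : M, TangentSpace I x,
    (∀ i, IsVectorField I (V i)) ∧ wedgePow I n η V x ≠ 0

/-- `ξ` is the Reeb vector field of `η`. -/
structure IsReebField [IsManifold I ∞ M] (η : Π x : M, TangentSpace I x →L[ℝ] ℝ)
    (ξ : Π x : M, TangentSpace I x) : Prop where
  smooth : IsVectorField I ξ
  eta_reeb : ∀ x, η x (ξ x) = 1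
  dEta_reeb : ∀ V, IsVectorField I V → ∀ x, dForm I η ξ V x = 0

/-- `(φ, ξ, η, g)` is a contact metric structure, where `g` is the Riemannian metric carried by
the tangent bundle. -/
structure IsContactMetric [IsManifold I ∞ M]
    [RiemannianBundle (fun x : M ↦ TangentSpace I x)]
    (n : ℕ) (φ : Π x : M, TangentSpace I x →L[ℝ] TangentSpace I x)
    (ξ : Π x : M, TangentSpace I x) (η : Π x : M, TangentSpace I x →L[ℝ] ℝ) : Prop where
  contact : IsContactForm I n η
  reeb : IsReebField I η ξ
  phi_smooth : IsSmoothEndo I φ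
  inner_reeb : ∀ (x : M) (v : TangentSpace I x), inner ℝ v (ξ x) = η x v
  phi_sq : ∀ (x : M) (v : TangentSpace I x), φ x (φ x v) = -v + η x v • ξ x
  dEta_eq : ∀ V W, IsVectorField I V → IsVectorField I W →
    ∀ x, dForm I η V W x = inner ℝ (V x) (φ x (W x))

/-- The tensor field `h = (1/2) 𝓛_ξ φ`, evaluated on the vector field `V`. -/
def hField (φ : Π x : M, TangentSpace I x →L[ℝ] TangentSpace I x)
    (ξ V : Π x : M, TangentSpace I x) : Π x : M, TangentSpace I x :=
  fun x ↦ (1 / 2 : ℝ) •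
    (VectorField.mlieBracket I ξ (app φ V) x - φ x (VectorField.mlieBracket I ξ V x))

/-! ### Distributions -/

/-- `V ∈ Γ(L)`: `V` is a smooth section of the distribution `L`. -/
structure IsSection [IsManifold I ∞ M] (L : Π x : M, Submodule ℝ (TangentSpace I x))
    (V : Π x : M, TangentSpace I x) : Prop where
  smooth : IsVectorField I V
  mem : ∀ x, V x ∈ L x

/-- `L` is a smooth rank-`k` subbundle of the tangent bundle. -/
def IsSubbundle [IsManifold I ∞ M] (k : ℕ) (L : Π x : M, Submodule ℝ (TangentSpace I x)) : Prop :=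
  ∀ x : M, ∃ U : Set M, IsOpen U ∧ x ∈ U ∧
    ∃ X : Fin k → Π y : M, TangentSpace I y,
      (∀ i, ContMDiffOn I I.tangent ∞ (fun y ↦ (⟨y, X i y⟩ : TangentBundle I M)) U) ∧
      ∀ y ∈ U, LinearIndependent ℝ (fun i ↦ X i y) ∧
        Submodule.span ℝ (Set.range fun i ↦ X i y) = L y

/-- `L` is a Legendrian distribution: a rank-`n` subbundle of the contact distribution `ker η`
on which `dη` vanishes. -/
structure IsLegendrian [IsManifold I ∞ M] (n : ℕ) (η : Π x : M, TangentSpace I x →L[ℝ] ℝ)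
    (L : Π x : M, Submodule ℝ (TangentSpace I x)) : Prop where
  subbundle : IsSubbundle I n L
  le_ker : ∀ x, ∀ v ∈ L x, η x v = 0
  isotropic : ∀ X X', IsSection I L X → IsSection I L X' → ∀ x, dForm I η X X' x = 0

/-- The conjugate distribution `φ L`. -/
def conj {I : ModelWithCorners ℝ E H} (φ : Π x : M, TangentSpace I x →L[ℝ] TangentSpace I x)
    (L : Π x : M, Submodule ℝ (TangentSpace I x)) : Π x : M, Submodule ℝ (TangentSpace I x) :=
  fun x ↦ (L x).map (φ x).toLinearMap

/-- The distribution `L ⊕ ℝξ`. -/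
def withReeb {I : ModelWithCorners ℝ E H} (ξ : Π x : M, TangentSpace I x)
    (L : Π x : M, Submodule ℝ (TangentSpace I x)) : Π x : M, Submodule ℝ (TangentSpace I x) :=
  fun x ↦ L x ⊔ Submodule.span ℝ {ξ x}

/-- `L` is integrable, i.e. closed under the Lie bracket, hence tangent to a foliation. -/
def IsIntegrable [IsManifold I ∞ M] (L : Π x : M, Submodule ℝ (TangentSpace I x)) : Prop :=
  ∀ X X', IsSection I L X → IsSection I L X' →
    ∀ x, VectorField.mlieBracket I X X' x ∈ L x

open Classical in
/-- The component `V_{L₁}` of the vector field `V` in the splitting `TM = L₁ ⊕ L₂ ⊕ ℝξ`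
(the value is meaningful only where these subspaces do split the tangent space). -/
def component {I : ModelWithCorners ℝ E H} (ξ : Π x : M, TangentSpace I x)
    (L₁ L₂ : Π x : M, Submodule ℝ (TangentSpace I x)) (V : Π x : M, TangentSpace I x) :
    Π x : M, TangentSpace I x :=
  fun x ↦ if h : IsCompl (L₁ x) (withReeb ξ L₂ x)
    then (L₁ x).projection (withReeb ξ L₂ x) h (V x) else 0

/-! ### Connections -/

/-- The vector field `∇_V W`. -/
def covDeriv {I : ModelWithCorners ℝ E H} [IsManifold I ∞ M]
    (D : CovariantDerivative I E (TangentSpace I : M → Type _))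
    (V W : Π x : M, TangentSpace I x) : Π x : M, TangentSpace I x :=
  fun x ↦ D W x (V x)

/-- `D` is the bi-Legendrian connection of `(M, η, L₁, L₂)`, where `ξ` is the Reeb vector field:
the smooth linear connection `∇` with `∇ L₁ ⊂ L₁`, `∇ L₂ ⊂ L₂`, `∇ ξ = 0`
(so `∇ (ℝξ) ⊂ ℝξ`), `∇ dη = 0`, and the prescribed torsion. -/
structure IsBiLegendrianConnection [IsManifold I ∞ M] [FiniteDimensional ℝ E]
    (η : Π x : M, TangentSpace I x →L[ℝ] ℝ) (ξ : Π x : M, TangentSpace I x)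
    (L₁ L₂ : Π x : M, Submodule ℝ (TangentSpace I x))
    (D : CovariantDerivative I E (TangentSpace I : M → Type _)) : Prop where
  smooth : D.ContMDiffCovariantDerivative ∞
  preserves₁ : ∀ V X, IsVectorField I V → IsSection I L₁ X → ∀ x, covDeriv D V X x ∈ L₁ x
  preserves₂ : ∀ V Y, IsVectorField I V → IsSection I L₂ Y → ∀ x, covDeriv D V Y x ∈ L₂ x
  reeb_parallel : ∀ V, IsVectorField I V → ∀ x, covDeriv D V ξ x = 0
  dEta_parallel : ∀ V W W', IsVectorField I V → IsVectorField I W → IsVectorField I W' → ∀ x,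
    dirDeriv I V (dForm I η W W') x =
      dForm I η (covDeriv D V W) W' x + dForm I η W (covDeriv D V W') x
  torsion_eq : ∀ X Y, IsSection I L₁ X → IsSection I L₂ Y → ∀ x,
    D.torsion x (X x) (Y x) = (2 * dForm I η X Y x) • ξ x
  torsion_reeb : ∀ V, IsVectorField I V → ∀ x,
    D.torsion x (V x) (ξ x) =
      component ξ L₂ L₁ (VectorField.mlieBracket I ξ (component ξ L₁ L₂ V)) x
      + component ξ L₁ L₂ (VectorField.mlieBracket I ξ (component ξ L₂ L₁ V)) x

/-- `∇ g = 0`, i.e. `V(g(W, W')) = g(∇_V W, W') + g(W, ∇_V W')`. -/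
def IsMetric [IsManifold I ∞ M] [RiemannianBundle (fun x : M ↦ TangentSpace I x)]
    (D : CovariantDerivative I E (TangentSpace I : M → Type _)) : Prop :=
  ∀ V W W', IsVectorField I V → IsVectorField I W → IsVectorField I W' → ∀ x,
    dirDeriv I V (fun y ↦ inner ℝ (W y) (W' y)) x =
      inner ℝ (covDeriv D V W x) (W' x) + inner ℝ (W x) (covDeriv D V W' x)

/-- `∇ φ = 0`. -/
def IsPhiParallel [IsManifold I ∞ M] (φ : Π x : M, TangentSpace I x →L[ℝ] TangentSpace I x)
    (D : CovariantDerivative I E (TangentSpace I : M → Type _)) : Prop :=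
  ∀ V W, IsVectorField I V → IsVectorField I W →
    ∀ x, covDeriv D V (app φ W) x - φ x (covDeriv D V W x) = 0

/-- `∇_X X' = -(φ [X, φ X'])_L` for all `X, X' ∈ Γ(L)`, where the component in `L` refers to
the splitting `TM = L ⊕ Q ⊕ ℝξ`. -/
def HasBracketFormula [IsManifold I ∞ M]
    (φ : Π x : M, TangentSpace I x →L[ℝ] TangentSpace I x) (ξ : Π x : M, TangentSpace I x)
    (L Q : Π x : M, Submodule ℝ (TangentSpace I x))
    (D : CovariantDerivative I E (TangentSpace I : M → Type _)) : Prop :=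
  ∀ X X', IsSection I L X → IsSection I L X' → ∀ x,
    covDeriv D X X' x =
      - component ξ L Q (app φ (VectorField.mlieBracket I X (app φ X'))) x

/-- The tensor field `h` preserves the distribution `L`. -/
def HPreserves [IsManifold I ∞ M]
    (φ : Π x : M, TangentSpace I x →L[ℝ] TangentSpace I x) (ξ : Π x : M, TangentSpace I x)
    (L : Π x : M, Submodule ℝ (TangentSpace I x)) : Prop :=
  ∀ X, IsSection I L X → ∀ x, hField I φ ξ X x ∈ L x

/-- The Lie derivative of the metric: `(𝓛_V g)(Z, Z')`. -/
def lieMetric [RiemannianBundle (fun x : M ↦ TangentSpace I x)]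
    (V Z Z' : Π x : M, TangentSpace I x) (x : M) : ℝ :=
  dirDeriv I V (fun y ↦ inner ℝ (Z y) (Z' y)) x
    - inner ℝ (VectorField.mlieBracket I V Z x) (Z' x)
    - inner ℝ (Z x) (VectorField.mlieBracket I V Z' x)

/-- `Z` is a smooth vector field orthogonal to the distribution `F`. -/
structure IsNormalField [IsManifold I ∞ M] [RiemannianBundle (fun x : M ↦ TangentSpace I x)]
    (F : Π x : M, Submodule ℝ (TangentSpace I x)) (Z : Π x : M, TangentSpace I x) : Prop where
  smooth : IsVectorField I Z
  orthogonal : ∀ x, ∀ u ∈ F x, inner ℝ u (Z x) = 0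

/-- The metric is bundle-like with respect to the distribution `F`: `(𝓛_V g)(Z, Z') = 0` for all
sections `V` of `F` and all vector fields `Z`, `Z'` orthogonal to `F`. -/
def IsBundleLike [IsManifold I ∞ M] [RiemannianBundle (fun x : M ↦ TangentSpace I x)]
    (F : Π x : M, Submodule ℝ (TangentSpace I x)) : Prop :=
  ∀ V Z Z', IsSection I F V → IsNormalField I F Z → IsNormalField I F Z' →
    ∀ x, lieMetric I V Z Z' x = 0

/-- `D` is the Levi-Civita connection: metric and torsion free. -/
def IsLeviCivita [IsManifold I ∞ M] [FiniteDimensional ℝ E]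
    [RiemannianBundle (fun x : M ↦ TangentSpace I x)]
    (D : CovariantDerivative I E (TangentSpace I : M → Type _)) : Prop :=
  IsMetric I D ∧ D.torsion = 0

/-- The foliation tangent to the integrable distribution `L` is totally geodesic, where `D` is the
Levi-Civita connection: the second fundamental form of the leaves vanishes. -/
def IsTotallyGeodesic [IsManifold I ∞ M]
    (D : CovariantDerivative I E (TangentSpace I : M → Type _))
    (L : Π x : M, Submodule ℝ (TangentSpace I x)) : Prop :=
  ∀ X X', IsSection I L X → IsSection I L X' → ∀ x, covDeriv D X X' x ∈ L x

end BiLegendrian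

end

namespace BiLegendrian

open VectorField

variable {E : Type*} [NormedAddCommGroup E] [NormedSpace ℝ E]
  {H : Type*} [TopologicalSpace H] {I : ModelWithCorners ℝ E H}
  {M : Type*} [TopologicalSpace M] [ChartedSpace H M]

/-! ### Smooth vector fields -/

/-! Write `∇` for the bi-Legendrian connection. Since `dη(V, W) = g(V, φ W)`, the condition `∇ dη =
0` turns `(∇_V g)(W, φ W')` into `-g(W, (∇_V φ) W')`. With `∇ ξ = 0` and `∇ η = 0`, it follows that
`g` and `φ` are parallel together.

The other conditions rest on `inner_covDeriv`. The torsion pairs `L ⊕ ℝξ` with `Q` without any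
`Q`-component, so `∇_V Z` and `[V, Z]` have the same `Q`-component for `V` in `L ⊕ ℝξ` and `Z` in
`Q`, and likewise with `L` and `Q` exchanged. Hence `∇_X (φ X')` is a bracket component, and `∇_X φ
= 0` on `L` becomes the bracket formula. In the direction of `ξ`, the `Q`-component of `2 h X` is
`(∇_ξ φ) X`.

By the same lemma `∇ g` on `Q × Q` in a direction of `L ⊕ ℝξ` is the Lie derivative of `g`
(`lieMetric_eq`), which is the bundle-like condition. The missing directions, those of `Q`, come
from `derivMetricTensor_phi_phi`: `φ` carries `∇ g` on `L` to minus `∇ g` on `Q`. Mixed blocks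
vanish because `∇` preserves the orthogonal splitting.

For integrable `L`, Koszul's formula identifies the Lie derivative of `g` along normals with the
second fundamental form (`lieMetric_eq_neg_two_mul`). -/

theorem contMDiffAt_det {k : ℕ} {A : M → Matrix (Fin k) (Fin k) ℝ} {x : M}
    (hA : ∀ i j, ContMDiffAt I 𝓘(ℝ) ∞ (fun y ↦ A y i j) x) :
    ContMDiffAt I 𝓘(ℝ) ∞ (fun y ↦ (A y).det) x := by
  simp only [Matrix.det_apply']
  refine contMDiffAt_finsetSum fun σ _ ↦ ?_
  exact contMDiffAt_const.mul (contMDiffAt_finsetProd fun i _ ↦ hA _ _)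

variable [IsManifold I ∞ M]

theorem IsVectorField.mdifferentiableAt {V : Π x : M, TangentSpace I x} (hV : IsVectorField I V)
    (x : M) : MDifferentiableAt I I.tangent (fun y ↦ (⟨y, V y⟩ : TangentBundle I M)) x :=
  (hV x).mdifferentiableAt (by simp)

theorem IsVectorField.add {V W : Π x : M, TangentSpace I x} (hV : IsVectorField I V)
    (hW : IsVectorField I W) : IsVectorField I (V + W) :=
  ContMDiff.add_section hV hW

theorem IsVectorField.neg {V : Π x : M, TangentSpace I x} (hV : IsVectorField I V) :
    IsVectorField I (-V) :=
  ContMDiff.neg_section hV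

theorem IsVectorField.smul {f : M → ℝ} {V : Π x : M, TangentSpace I x}
    (hf : ContMDiff I 𝓘(ℝ) ∞ f) (hV : IsVectorField I V) : IsVectorField I (f • V) :=
  ContMDiff.smul_section hf hV

theorem IsSmoothEndo.isVectorField_app {φ : Π x : M, TangentSpace I x →L[ℝ] TangentSpace I x}
    (hφ : IsSmoothEndo I φ) {V : Π x : M, TangentSpace I x} (hV : IsVectorField I V) :
    IsVectorField I (app φ V) :=
  ContMDiff.clm_bundle_apply (F₁ := E) (F₂ := E) hφ hV

theorem IsSmoothOneForm.contMDiff_apply {η : Π x : M, TangentSpace I x →L[ℝ] ℝ}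
    (hη : IsSmoothOneForm I η) {V : Π x : M, TangentSpace I x} (hV : IsVectorField I V) :
    ContMDiff I 𝓘(ℝ) ∞ (fun x ↦ η x (V x)) := by
  intro x
  have h : ContMDiffAt I (I.prod 𝓘(ℝ)) ∞
      (fun m ↦ TotalSpace.mk' ℝ (E := Bundle.Trivial M ℝ) m (η m (V m))) x :=
    ContMDiffAt.clm_bundle_apply (F₁ := E) (F₂ := ℝ) (E₂ := Bundle.Trivial M ℝ) (hη x) (hV x)
  simp only [contMDiffAt_totalSpace] at h
  exact h.2

theorem isVectorField_covDeriv {D : CovariantDerivative I E (TangentSpace I : M → Type _)}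
    (hD : D.ContMDiffCovariantDerivative ∞) {V W : Π x : M, TangentSpace I x}
    (hV : IsVectorField I V) (hW : IsVectorField I W) : IsVectorField I (covDeriv D V W) := by
  have h := hD.contMDiff.contMDiff (σ := W) (by exact ContMDiff.contMDiffOn hW)
  exact ContMDiff.clm_bundle_apply (F₁ := E) (F₂ := E) (contMDiffOn_univ.1 h) hV

/-! ### Global fields and sections with a prescribed value at a point -/

section Extension

variable [FiniteDimensional ℝ E] [T2Space M]

/-- Local sections can be cut off to global ones without changing their value at a point. -/
theorem exists_isVectorField_of_contMDiffOn {U : Set M} (hU : IsOpen U) {x : M}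
    (hx : x ∈ U) {V : Π x : M, TangentSpace I x}
    (hV : ContMDiffOn I I.tangent ∞ (fun y ↦ (⟨y, V y⟩ : TangentBundle I M)) U) :
    ∃ f : M → ℝ, f x = 1 ∧ (∀ y ∉ U, f y = 0) ∧ IsVectorField I (f • V) := by
  obtain ⟨f, hf, -⟩ := (SmoothBumpFunction.nhds_basis_support (I := I)
    (hU.mem_nhds hx)).mem_iff.1 Filter.univ_mem
  exact ⟨f, f.eq_one, fun y hy ↦ image_eq_zero_of_notMem_tsupport fun h ↦ hy (hf h),
    ContMDiffOn.smul_section_of_tsupport f.contMDiff.contMDiffOn hU hf hV⟩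

/-- Converts identities stated for global fields into identities for tangent vectors. -/
theorem exists_isVectorField_eq (x : M) (v : TangentSpace I x) :
    ∃ V : Π x : M, TangentSpace I x, IsVectorField I V ∧ V x = v := by
  obtain ⟨s, hs, h⟩ := FiberBundle.exists_contMDiffOn_extend (k := ∞) I E v
  obtain ⟨U, hUs, hU, hx⟩ := mem_nhds_iff.1 hs
  obtain ⟨f, h1, -, hf⟩ := exists_isVectorField_of_contMDiffOn hU hx (h.mono hUs)
  exact ⟨_, hf, by simp [h1]⟩

/-- Every vector of a subbundle extends to a global section. -/
theorem IsSubbundle.exists_isSection_eq {k : ℕ}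
    {L : Π x : M, Submodule ℝ (TangentSpace I x)}
    (hL : IsSubbundle I k L) {x : M} {v : TangentSpace I x} (hv : v ∈ L x) :
    ∃ X, IsSection I L X ∧ X x = v := by
  obtain ⟨U, hU, hx, X, hX, h⟩ := hL x
  rw [← (h x hx).2, Submodule.mem_span_range_iff_exists_fun] at hv
  obtain ⟨c, rfl⟩ := hv
  obtain ⟨f, h1, h0, hf⟩ := exists_isVectorField_of_contMDiffOn hU hx
    (V := fun y ↦ ∑ i, c i • X i y)
    (ContMDiffOn.sum_section fun i _ ↦ ContMDiffOn.const_smul_section (a := c i) (hX i))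
  refine ⟨_, ⟨hf, fun y ↦ ?_⟩, by simp [h1]⟩
  -- The frame is controlled only on `U`; elsewhere the cutoff makes the field zero.
  by_cases hy : y ∈ U
  · rw [← (h y hy).2]
    exact Submodule.smul_mem _ _ (Submodule.sum_mem _ fun i _ ↦
      Submodule.smul_mem _ _ (Submodule.subset_span ⟨i, rfl⟩))
  · simp [h0 y hy]

end Extension

instance [FiniteDimensional ℝ E] (x : M) : FiniteDimensional ℝ (TangentSpace I x) :=
  inferInstanceAs (FiniteDimensional ℝ E)

/-! ### Smoothness of inner products and orthogonal projections -/

variable [RiemannianBundle (fun x : M ↦ TangentSpace I x)]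
  [IsContMDiffRiemannianBundle I ∞ E (fun x : M ↦ TangentSpace I x)]

theorem IsVectorField.contMDiff_inner {V W : Π x : M, TangentSpace I x} (hV : IsVectorField I V)
    (hW : IsVectorField I W) : ContMDiff I 𝓘(ℝ) ∞ (fun y ↦ inner ℝ (V y) (W y)) :=
  ContMDiff.inner_bundle hV hW

/-- The orthogonal projection of a smooth vector field to a subbundle is smooth: on a local frame
its coefficients are computed from the Gram matrix by Cramer's rule. -/
theorem IsSubbundle.isVectorField_starProjection [FiniteDimensional ℝ E] {k : ℕ}
    {L : Π x : M, Submodule ℝ (TangentSpace I x)} (hL : IsSubbundle I k L)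
    {V : Π x : M, TangentSpace I x} (hV : IsVectorField I V) :
    IsVectorField I (fun x ↦ (L x).starProjection (V x)) := by
  intro x
  obtain ⟨U, hU, hx, X, hX, h⟩ := hL x
  let G : M → Matrix (Fin k) (Fin k) ℝ := fun y ↦ Matrix.gram ℝ (fun i ↦ X i y)
  let b : M → Fin k → ℝ := fun y i ↦ inner ℝ (X i y) (V y)
  have hXx : ∀ i, ContMDiffAt I I.tangent ∞ (fun y ↦ (⟨y, X i y⟩ : TangentBundle I M)) x :=
    fun i ↦ (hX i).contMDiffAt (hU.mem_nhds hx)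
  have hG : ∀ i j, ContMDiffAt I 𝓘(ℝ) ∞ (fun y ↦ G y i j) x := fun i j ↦
    ContMDiffAt.inner_bundle (F := E) (E := fun x : M ↦ TangentSpace I x) (hXx i) (hXx j)
  have hb : ∀ i, ContMDiffAt I 𝓘(ℝ) ∞ (fun y ↦ b y i) x := fun i ↦
    ContMDiffAt.inner_bundle (F := E) (E := fun x : M ↦ TangentSpace I x) (hXx i) (hV x)
  have hdet : ∀ y ∈ U, (G y).det ≠ 0 := fun y hy ↦
    (Matrix.posDef_gram_of_linearIndependent (h y hy).1).det_pos.ne'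
  let c : M → Fin k → ℝ := fun y i ↦ (G y).det⁻¹ * (G y).cramer (b y) i
  have hc : ∀ i, ContMDiffAt I 𝓘(ℝ) ∞ (fun y ↦ c y i) x := by
    intro i
    refine ContMDiffAt.mul ((contMDiffAt_det hG).inv₀ (hdet x hx)) ?_
    -- The numerator is the determinant of the Gram matrix with column `i` replaced by `b`.
    simp only [Matrix.cramer_apply]
    refine contMDiffAt_det fun p q ↦ ?_
    by_cases hq : q = i
    · subst hq; simpa using hb p
    · simpa [hq] using hG p q
  have key : ContMDiffAt I I.tangent ∞
      (fun y ↦ (⟨y, ∑ i, c y i • X i y⟩ : TangentBundle I M)) x :=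
    ContMDiffAt.sum_section fun i _ ↦ ContMDiffAt.smul_section (hc i) (hXx i)
  refine key.congr_of_eventuallyEq ?_
  filter_upwards [hU.mem_nhds hx] with y hy
  congr 1
  refine Submodule.eq_starProjection_of_mem_of_inner_eq_zero ?_ ?_
  · rw [← (h y hy).2]
    exact Submodule.sum_mem _ fun i _ ↦
      Submodule.smul_mem _ _ (Submodule.subset_span ⟨i, rfl⟩)
  · intro w hw
    rw [← (h y hy).2, Submodule.mem_span_range_iff_exists_fun] at hw
    obtain ⟨a, rfl⟩ := hw
    simp only [inner_sum, inner_smul_right]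
    refine Finset.sum_eq_zero fun j _ ↦ ?_
    -- Cramer's identity `G (cramer b) = det G • b` says that `∑ c i • X i` and `V` have equal inner
    -- products with every frame field.
    have hj := congrFun (Matrix.mulVec_cramer (G y) (b y)) j
    have : inner ℝ (X j y) (∑ i, c y i • X i y) = inner ℝ (X j y) (V y) := by
      simp only [inner_sum, inner_smul_right, c]
      simp only [mul_assoc, ← Finset.mul_sum]
      rw [inv_mul_eq_iff_eq_mul₀ (hdet y hy)]
      simpa [Matrix.mulVec, dotProduct, G, b, Matrix.gram_apply, mul_comm] using hj
    rw [inner_sub_left, real_inner_comm, real_inner_comm (X j y), this, sub_self, mul_zero]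

/-! ### Contact metric structures and their Legendrian splittings -/

set_option linter.unusedSectionVars false

section Splitting

variable {E : Type*} [NormedAddCommGroup E] [NormedSpace ℝ E]
  {H : Type*} [TopologicalSpace H] {I : ModelWithCorners ℝ E H}
  {M : Type*} [TopologicalSpace M] [ChartedSpace H M]

theorem dForm_swap (η : Π x : M, TangentSpace I x →L[ℝ] ℝ) (V W : Π x : M, TangentSpace I x)
    (x : M) : dForm I η V W x = -dForm I η W V x := by
  simp only [dForm, mlieBracket_swap_apply (V := V) (W := W), map_neg]
  ring

variable [FiniteDimensional ℝ E] [T2Space M] [IsManifold I ∞ M]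
  [RiemannianBundle (fun x : M ↦ TangentSpace I x)]
  {n : ℕ} {φ : Π x : M, TangentSpace I x →L[ℝ] TangentSpace I x}
  {ξ : Π x : M, TangentSpace I x} {η : Π x : M, TangentSpace I x →L[ℝ] ℝ}
  {L Q : Π x : M, Submodule ℝ (TangentSpace I x)}

/-! ### Pointwise algebra of a contact metric structure -/

namespace IsContactMetric

/-- Skewness of `φ` is antisymmetry of `dη`. -/
theorem inner_phi_left (hM : IsContactMetric I n φ ξ η) {x : M} (v w : TangentSpace I x) :
    inner ℝ (φ x v) w = -inner ℝ v (φ x w) := by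
  obtain ⟨V, hV, rfl⟩ := exists_isVectorField_eq x v
  obtain ⟨W, hW, rfl⟩ := exists_isVectorField_eq x w
  rw [← hM.dEta_eq V W hV hW, dForm_swap, neg_neg, hM.dEta_eq W V hW hV, real_inner_comm]

theorem phi_reeb (hM : IsContactMetric I n φ ξ η) (x : M) : φ x (ξ x) = 0 := by
  refine ext_inner_left ℝ fun v ↦ ?_
  obtain ⟨V, hV, rfl⟩ := exists_isVectorField_eq x v
  rw [← hM.dEta_eq V ξ hV hM.reeb.smooth, dForm_swap, hM.reeb.dEta_reeb V hV, neg_zero,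
    inner_zero_right]

theorem eta_phi (hM : IsContactMetric I n φ ξ η) {x : M} (v : TangentSpace I x) :
    η x (φ x v) = 0 := by
  rw [← hM.inner_reeb, hM.inner_phi_left, hM.phi_reeb, inner_zero_right, neg_zero]

theorem inner_phi_phi (hM : IsContactMetric I n φ ξ η) {x : M} (v w : TangentSpace I x) :
    inner ℝ (φ x v) (φ x w) = inner ℝ v w - η x v * η x w := by
  rw [hM.inner_phi_left, hM.phi_sq, inner_add_right, inner_neg_right, inner_smul_right,
    hM.inner_reeb]
  ring

theorem phi_phi_of_eta_eq_zero (hM : IsContactMetric I n φ ξ η) {x : M} {v : TangentSpace I x}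
    (hv : η x v = 0) : φ x (φ x v) = -v := by
  simp [hM.phi_sq, hv]

theorem eta_mlieBracket (hM : IsContactMetric I n φ ξ η) {V W : Π x : M, TangentSpace I x}
    (hV : IsVectorField I V) (hW : IsVectorField I W) (x : M) :
    η x (mlieBracket I V W x) = dirDeriv I V (fun y ↦ η y (W y)) x
      - dirDeriv I W (fun y ↦ η y (V y)) x - 2 * inner ℝ (V x) (φ x (W x)) := by
  rw [← hM.dEta_eq V W hV hW, dForm]
  ring

end IsContactMetric

theorem dirDeriv_eq_zero_of_const {V : Π x : M, TangentSpace I x} {f : M → ℝ} {c : ℝ}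
    (hf : ∀ y, f y = c) (x : M) : dirDeriv I V f x = 0 := by
  obtain rfl : f = fun _ ↦ c := funext hf
  rw [dirDeriv, mvfderiv_const]
  rfl

/-- The distributions `L` and `Q` are tangent to the contact distribution, orthogonal to each
other, interchanged by `φ`, and together with the Reeb field they span the tangent bundle. -/
structure IsSplitting (φ : Π x : M, TangentSpace I x →L[ℝ] TangentSpace I x)
    (ξ : Π x : M, TangentSpace I x) (η : Π x : M, TangentSpace I x →L[ℝ] ℝ)
    (L Q : Π x : M, Submodule ℝ (TangentSpace I x)) : Prop where
  eta_left : ∀ {x : M} {v : TangentSpace I x}, v ∈ L x → η x v = 0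
  eta_right : ∀ {x : M} {v : TangentSpace I x}, v ∈ Q x → η x v = 0
  phi_left : ∀ {x : M} {v : TangentSpace I x}, v ∈ L x → φ x v ∈ Q x
  phi_right : ∀ {x : M} {v : TangentSpace I x}, v ∈ Q x → φ x v ∈ L x
  inner_eq_zero : ∀ {x : M} {v w : TangentSpace I x}, v ∈ L x → w ∈ Q x → inner ℝ v w = 0
  exists_eq_add : ∀ {V : Π x : M, TangentSpace I x}, IsVectorField I V →
    ∃ X Y, IsSection I L X ∧ IsSection I Q Y ∧ ∀ x, V x = X x + Y x + η x (V x) • ξ x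

/-! ### Components in the orthogonal splitting -/

namespace IsSplitting

/-- The roles of `L` and `Q` are interchangeable, so later lemmas are proved for one side only. -/
theorem symm (h : IsSplitting φ ξ η L Q) : IsSplitting φ ξ η Q L where
  eta_left := h.eta_right
  eta_right := h.eta_left
  phi_left := h.phi_right
  phi_right := h.phi_left
  inner_eq_zero hv hw := by rw [real_inner_comm, h.inner_eq_zero hw hv]
  exists_eq_add hV := by
    obtain ⟨X, Y, hX, hY, e⟩ := h.exists_eq_add hV
    exact ⟨Y, X, hY, hX, fun x ↦ by rw [add_comm (Y x)]; exact e x⟩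

theorem exists_mem_eq_add (h : IsSplitting φ ξ η L Q) {x : M} (v : TangentSpace I x) :
    ∃ a ∈ L x, ∃ b ∈ Q x, v = a + b + η x v • ξ x := by
  obtain ⟨V, hV, rfl⟩ := exists_isVectorField_eq x v
  obtain ⟨X, Y, hX, hY, e⟩ := h.exists_eq_add hV
  exact ⟨X x, hX.mem x, Y x, hY.mem x, e x⟩

theorem mem_left (h : IsSplitting φ ξ η L Q) {x : M} {v : TangentSpace I x} (hη : η x v = 0)
    (hv : ∀ q ∈ Q x, inner ℝ v q = 0) : v ∈ L x := by
  obtain ⟨a, ha, b, hb, e⟩ := h.exists_mem_eq_add v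
  rw [hη, zero_smul, add_zero] at e
  have hb0 : inner ℝ b b = 0 := by
    have := hv b hb
    rwa [e, inner_add_left, h.inner_eq_zero ha hb, zero_add] at this
  rw [inner_self_eq_zero] at hb0
  rwa [e, hb0, add_zero]

/-- The `L`-part of any extension of `v` works. No local frame is used, so this applies to `Q` as
well through `symm`. -/
theorem exists_isSection_eq (h : IsSplitting φ ξ η L Q) {x : M} {v : TangentSpace I x}
    (hv : v ∈ L x) : ∃ X, IsSection I L X ∧ X x = v := by
  obtain ⟨V, hV, rfl⟩ := exists_isVectorField_eq x v
  obtain ⟨X, Y, hX, hY, e⟩ := h.exists_eq_add hV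
  have e := e x
  rw [h.eta_left hv, zero_smul, add_zero] at e
  refine ⟨X, hX, ?_⟩
  have : inner ℝ (Y x) (Y x) = 0 := by
    have := h.inner_eq_zero hv (hY.mem x)
    rwa [e, inner_add_left, h.inner_eq_zero (hX.mem x) (hY.mem x), zero_add] at this
  rw [e, inner_self_eq_zero.1 this, add_zero]

theorem inner_withReeb_eq_zero (h : IsSplitting φ ξ η L Q) (hM : IsContactMetric I n φ ξ η)
    {x : M} {v w : TangentSpace I x} (hv : v ∈ L x) (hw : w ∈ withReeb ξ Q x) :
    inner ℝ v w = 0 := by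
  obtain ⟨b, hb, c, hc, rfl⟩ := Submodule.mem_sup.1 hw
  obtain ⟨t, rfl⟩ := Submodule.mem_span_singleton.1 hc
  rw [inner_add_right, h.inner_eq_zero hv hb, inner_smul_right, hM.inner_reeb, h.eta_left hv]
  simp

theorem isCompl (h : IsSplitting φ ξ η L Q) (hM : IsContactMetric I n φ ξ η) (x : M) :
    IsCompl (L x) (withReeb ξ Q x) := by
  constructor
  · rw [Submodule.disjoint_def]
    exact fun v hv hw ↦ inner_self_eq_zero.1 (h.inner_withReeb_eq_zero hM hv hw)
  · rw [codisjoint_iff, Submodule.eq_top_iff']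
    intro v
    obtain ⟨a, ha, b, hb, e⟩ := h.exists_mem_eq_add v
    rw [e, add_assoc]
    exact Submodule.add_mem_sup ha (Submodule.add_mem_sup hb
      (Submodule.smul_mem _ _ (Submodule.mem_span_singleton_self _)))

theorem component_mem (h : IsSplitting φ ξ η L Q) (hM : IsContactMetric I n φ ξ η)
    (V : Π x : M, TangentSpace I x) (x : M) : component ξ L Q V x ∈ L x := by
  rw [component, dif_pos (h.isCompl hM x)]
  exact Submodule.projection_apply_mem _ _

/-- Orthogonality of the splitting makes components detectable by inner products; with
`eq_of_inner_eq` this replaces computations with projections. -/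
theorem inner_component (h : IsSplitting φ ξ η L Q) (hM : IsContactMetric I n φ ξ η)
    (V : Π x : M, TangentSpace I x) {x : M} {q : TangentSpace I x} (hq : q ∈ L x) :
    inner ℝ (component ξ L Q V x) q = inner ℝ (V x) q := by
  rw [component, dif_pos (h.isCompl hM x)]
  have := h.inner_withReeb_eq_zero hM hq (Submodule.sub_projection_mem (h.isCompl hM x) (V x))
  rw [inner_sub_right, sub_eq_zero] at this
  rw [real_inner_comm, ← this, real_inner_comm]

theorem eq_of_inner_eq {L : Π x : M, Submodule ℝ (TangentSpace I x)} {x : M}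
    {v w : TangentSpace I x} (hv : v ∈ L x) (hw : w ∈ L x)
    (h : ∀ q ∈ L x, inner ℝ v q = inner ℝ w q) : v = w := by
  have := h _ (Submodule.sub_mem _ hv hw)
  rw [← sub_eq_zero, ← inner_sub_left, inner_self_eq_zero, sub_eq_zero] at this
  exact this

theorem component_of_isSection_right (h : IsSplitting φ ξ η L Q)
    (hM : IsContactMetric I n φ ξ η) {Y : Π x : M, TangentSpace I x} (hY : IsSection I Q Y) :
    component ξ L Q Y = 0 :=
  funext fun x ↦ eq_of_inner_eq (h.component_mem hM Y x) (Submodule.zero_mem _) fun q hq ↦ by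
    rw [h.inner_component hM Y hq, Pi.zero_apply, inner_zero_left, real_inner_comm,
      h.inner_eq_zero hq (hY.mem x)]

theorem isSection_app (h : IsSplitting φ ξ η L Q) (hM : IsContactMetric I n φ ξ η)
    {X : Π x : M, TangentSpace I x} (hX : IsSection I L X) : IsSection I Q (app φ X) :=
  ⟨hM.phi_smooth.isVectorField_app hX.smooth, fun x ↦ h.phi_left (hX.mem x)⟩

/-- `η(X)` and `η(ξ)` are constant, and `dη(ξ, X) = η(φ X) = 0`. -/
theorem eta_reeb_bracket (h : IsSplitting φ ξ η L Q) (hM : IsContactMetric I n φ ξ η)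
    {X : Π x : M, TangentSpace I x} (hX : IsSection I L X) (x : M) :
    η x (mlieBracket I ξ X x) = 0 := by
  rw [hM.eta_mlieBracket hM.reeb.smooth hX.smooth,
    dirDeriv_eq_zero_of_const fun y ↦ h.eta_left (hX.mem y),
    dirDeriv_eq_zero_of_const hM.reeb.eta_reeb, real_inner_comm, hM.inner_reeb, hM.eta_phi]
  simp

theorem isNormalField_withReeb_iff (h : IsSplitting φ ξ η L Q) (hM : IsContactMetric I n φ ξ η)
    {Z : Π x : M, TangentSpace I x} :
    IsNormalField I (withReeb ξ L) Z ↔ IsSection I Q Z := by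
  constructor
  · intro hZ
    refine ⟨hZ.smooth, fun x ↦ h.symm.mem_left ?_ fun q hq ↦ ?_⟩
    · rw [← hM.inner_reeb, real_inner_comm]
      exact hZ.orthogonal x _ (Submodule.mem_sup_right (Submodule.mem_span_singleton_self _))
    · rw [real_inner_comm]
      exact hZ.orthogonal x _ (Submodule.mem_sup_left hq)
  · intro hZ
    refine ⟨hZ.smooth, fun x u hu ↦ ?_⟩
    rw [real_inner_comm, h.symm.inner_withReeb_eq_zero hM (hZ.mem x) hu]

end IsSplitting

/-- A Legendrian distribution and its conjugate split the tangent bundle orthogonally. -/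
theorem IsContactMetric.isSplitting
    [IsContMDiffRiemannianBundle I ∞ E (fun x : M ↦ TangentSpace I x)]
    (hM : IsContactMetric I n φ ξ η) (hL : IsLegendrian I n η L) :
    IsSplitting φ ξ η L (conj φ L) := by
  -- Isotropy of `L` reads `g(X, φ X') = 0`.
  have orth : ∀ {x : M} {v w : TangentSpace I x}, v ∈ L x → w ∈ conj φ L x →
      inner ℝ v w = 0 := by
    rintro x v _ hv ⟨w, hw, rfl⟩
    obtain ⟨X, hX, rfl⟩ := hL.subbundle.exists_isSection_eq hv
    obtain ⟨X', hX', rfl⟩ := hL.subbundle.exists_isSection_eq hw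
    exact (hM.dEta_eq X X' hX.smooth hX'.smooth x).symm.trans (hL.isotropic X X' hX hX' x)
  have phi_right : ∀ {x : M} {v : TangentSpace I x}, v ∈ conj φ L x → φ x v ∈ L x := by
    rintro x _ ⟨w, hw, rfl⟩
    have := hM.phi_phi_of_eta_eq_zero (hL.le_ker x w hw)
    simpa [this] using hw
  have eta_right : ∀ {x : M} {v : TangentSpace I x}, v ∈ conj φ L x → η x v = 0 := by
    rintro x _ ⟨w, hw, rfl⟩
    exact hM.eta_phi w
  -- Dimension count: `n + n + 1`, the three summands being independent.
  have top : ∀ x, L x ⊔ conj φ L x ⊔ Submodule.span ℝ {ξ x} = ⊤ := by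
    intro x
    refine Submodule.eq_top_of_finrank_eq ?_
    have hξ : ξ x ≠ 0 := fun h ↦ by simpa [h] using hM.reeb.eta_reeb x
    have h1 : Module.finrank ℝ (L x) = n := by
      obtain ⟨U, -, hx, X, -, h⟩ := hL.subbundle x
      rw [← (h x hx).2, finrank_span_eq_card (h x hx).1, Fintype.card_fin]
    have h2 : Module.finrank ℝ (conj φ L x) = n := by
      refine le_antisymm (h1 ▸ Submodule.finrank_map_le _ _) ?_
      rw [← h1]
      -- As `φ² = -1` on `L`, `L` lies in `φ(φ L)`, so applying `φ` loses no dimension.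
      refine (Submodule.finrank_mono fun v hv ↦ ?_).trans
        (Submodule.finrank_map_le (φ x).toLinearMap (conj φ L x))
      exact ⟨-φ x v, Submodule.neg_mem _ ⟨v, hv, rfl⟩, by
        simp [hM.phi_phi_of_eta_eq_zero (hL.le_ker x v hv)]⟩
    have d1 : L x ⊓ conj φ L x = ⊥ := (Submodule.disjoint_def.2 fun v hv hw ↦
      inner_self_eq_zero.1 (orth hv hw)).eq_bot
    have d2 : (L x ⊔ conj φ L x) ⊓ Submodule.span ℝ {ξ x} = ⊥ := by
      refine (Submodule.disjoint_def.2 fun v hv hw ↦ ?_).eq_bot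
      obtain ⟨a, ha, b, hb, rfl⟩ := Submodule.mem_sup.1 hv
      obtain ⟨t, ht⟩ := Submodule.mem_span_singleton.1 hw
      have := congrArg (η x) ht
      rw [map_smul, hM.reeb.eta_reeb, map_add, hL.le_ker x a ha, eta_right hb] at this
      rw [← ht]
      simp_all
    have e1 := Submodule.finrank_sup_add_finrank_inf_eq (L x) (conj φ L x)
    have e2 := Submodule.finrank_sup_add_finrank_inf_eq (L x ⊔ conj φ L x)
      (Submodule.span ℝ {ξ x})
    have hE : Module.finrank ℝ (TangentSpace I x) = 2 * n + 1 := hM.contact.finrank_eq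
    rw [d1, finrank_bot] at e1
    rw [d2, finrank_bot, finrank_span_singleton hξ] at e2
    omega
  refine ⟨fun {x v} hv ↦ hL.le_ker x v hv, eta_right, fun {x v} hv ↦ ⟨v, hv, rfl⟩, phi_right,
    orth, fun {V} hV ↦ ?_⟩
  let X : Π x : M, TangentSpace I x := fun x ↦ (L x).starProjection (V x)
  -- The `Q`-part of `V` is `-φ` of the `L`-projection of `φ V`, so its smoothness needs only a
  -- frame of `L`.
  let X' : Π x : M, TangentSpace I x := fun x ↦ (L x).starProjection (φ x (V x))
  have hX : IsVectorField I X := hL.subbundle.isVectorField_starProjection hV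
  have hX' : IsVectorField I X' :=
    hL.subbundle.isVectorField_starProjection (hM.phi_smooth.isVectorField_app hV)
  refine ⟨X, -app φ X', ⟨hX, fun x ↦ Submodule.starProjection_apply_mem _ _⟩,
    ⟨(hM.phi_smooth.isVectorField_app hX').neg, fun x ↦ Submodule.neg_mem _
      ⟨X' x, Submodule.starProjection_apply_mem _ _, rfl⟩⟩, fun x ↦ ?_⟩
  have hv : V x ∈ L x ⊔ conj φ L x ⊔ Submodule.span ℝ {ξ x} := by rw [top]; trivial
  obtain ⟨c, hc, d, hd, e⟩ := Submodule.mem_sup.1 hv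
  obtain ⟨a, ha, b, hb, rfl⟩ := Submodule.mem_sup.1 hc
  obtain ⟨t, rfl⟩ := Submodule.mem_span_singleton.1 hd
  have hηt : η x (V x) = t := by
    rw [← e]
    simp [hL.le_ker x a ha, eta_right hb, hM.reeb.eta_reeb]
  have hXa : X x = a := by
    refine Submodule.eq_starProjection_of_mem_of_inner_eq_zero ha fun w hw ↦ ?_
    rw [← e, real_inner_comm, inner_sub_right, inner_add_right, inner_add_right, orth hw hb,
      inner_smul_right, hM.inner_reeb, hL.le_ker x w hw]
    ring
  have hXb : X' x = φ x b := by
    refine Submodule.eq_starProjection_of_mem_of_inner_eq_zero (phi_right hb) fun w hw ↦ ?_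
    rw [← e, map_add, map_add, map_smul, hM.phi_reeb, smul_zero, add_zero, add_sub_cancel_right,
      real_inner_comm]
    exact orth hw ⟨a, ha, rfl⟩
  simp only [Pi.neg_apply, app, hXa, hXb, hM.phi_phi_of_eta_eq_zero (eta_right hb), hηt,
    neg_neg]
  exact e.symm

end Splitting

section Connection

variable {E : Type*} [NormedAddCommGroup E] [NormedSpace ℝ E]
  {H : Type*} [TopologicalSpace H] {I : ModelWithCorners ℝ E H}
  {M : Type*} [TopologicalSpace M] [ChartedSpace H M]
  [FiniteDimensional ℝ E] [T2Space M] [IsManifold I ∞ M]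
  [RiemannianBundle (fun x : M ↦ TangentSpace I x)]
  [IsContMDiffRiemannianBundle I ∞ E (fun x : M ↦ TangentSpace I x)]
  {n : ℕ} {φ : Π x : M, TangentSpace I x →L[ℝ] TangentSpace I x}
  {ξ : Π x : M, TangentSpace I x} {η : Π x : M, TangentSpace I x →L[ℝ] ℝ}
  {L Q : Π x : M, Submodule ℝ (TangentSpace I x)}
  {D : CovariantDerivative I E (TangentSpace I : M → Type _)}

/-! ### Connections -/

theorem covDeriv_add (V : Π x : M, TangentSpace I x) {X Y : Π x : M, TangentSpace I x}
    (hX : IsVectorField I X) (hY : IsVectorField I Y) (x : M) :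
    covDeriv D V (X + Y) x = covDeriv D V X x + covDeriv D V Y x := by
  simp only [covDeriv, D.isCovariantDerivativeOnUniv.add (hX.mdifferentiableAt x)
    (hY.mdifferentiableAt x)]
  rfl

theorem covDeriv_smul (V : Π x : M, TangentSpace I x) {f : M → ℝ}
    (hf : ContMDiff I 𝓘(ℝ) ∞ f) {X : Π x : M, TangentSpace I x}
    (hX : IsVectorField I X) (x : M) :
    covDeriv D V (f • X) x = f x • covDeriv D V X x + dirDeriv I V f x • X x := by
  simp only [covDeriv, D.isCovariantDerivativeOnUniv.leibniz (hX.mdifferentiableAt x)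
    ((hf x).mdifferentiableAt (by simp))]
  rfl

theorem torsion_apply {V W : Π x : M, TangentSpace I x} (hV : IsVectorField I V)
    (hW : IsVectorField I W) (x : M) :
    D.torsion x (V x) (W x) = covDeriv D V W x - covDeriv D W V x - mlieBracket I V W x :=
  D.torsion_apply (hV.mdifferentiableAt x) (hW.mdifferentiableAt x)

/-- The value of the tensor `∇ g`. -/
theorem derivMetricTensor_apply (V : Π x : M, TangentSpace I x) {W W' : Π x : M, TangentSpace I x}
    (hW : IsVectorField I W) (hW' : IsVectorField I W') (x : M) :
    D.derivMetricTensor x (W x) (W' x) (V x) = dirDeriv I V (fun y ↦ inner ℝ (W y) (W' y)) x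
      - inner ℝ (covDeriv D V W x) (W' x) - inner ℝ (W x) (covDeriv D V W' x) := by
  have h := hW.mdifferentiableAt x
  have h' := hW'.mdifferentiableAt x
  have := CovariantDerivative.derivMetricTensor_apply (F := E)
    (V := fun x : M ↦ TangentSpace I x) (σ := W) (τ := W') (X := V) D x h h'
  simp only [dirDeriv, covDeriv]
  exact this

/-- Passing to the tensor `∇ g` allows checking on vectors of each summand separately. -/
theorem isMetric_iff :
    IsMetric I D ↔ ∀ (x : M) (v w w' : TangentSpace I x), D.derivMetricTensor x w w' v = 0 := by
  constructor
  · intro h x v w w'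
    obtain ⟨V, hV, rfl⟩ := exists_isVectorField_eq x v
    obtain ⟨W, hW, rfl⟩ := exists_isVectorField_eq x w
    obtain ⟨W', hW', rfl⟩ := exists_isVectorField_eq x w'
    rw [derivMetricTensor_apply V hW hW', h V W W' hV hW hW']
    ring
  · intro h V W W' hV hW hW' x
    have := h x (V x) (W x) (W' x)
    rw [derivMetricTensor_apply V hW hW'] at this
    linarith

/-! ### Torsion and bracket identities of the bi-Legendrian connection -/

namespace IsBiLegendrianConnection

theorem symm (hD : IsBiLegendrianConnection I η ξ L Q D) :
    IsBiLegendrianConnection I η ξ Q L D where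
  smooth := hD.smooth
  preserves₁ := hD.preserves₂
  preserves₂ := hD.preserves₁
  reeb_parallel := hD.reeb_parallel
  dEta_parallel := hD.dEta_parallel
  torsion_eq X Y hX hY x := by
    rw [D.torsion_antisymm, hD.torsion_eq Y X hY hX, dForm_swap]
    module
  torsion_reeb V hV x := by rw [hD.torsion_reeb V hV, add_comm]

/-- The defining relation `∇ dη = 0` in terms of the metric. -/
theorem dirDeriv_inner_phi (hD : IsBiLegendrianConnection I η ξ L Q D)
    (hM : IsContactMetric I n φ ξ η) {V W W' : Π x : M, TangentSpace I x}
    (hV : IsVectorField I V) (hW : IsVectorField I W) (hW' : IsVectorField I W') (x : M) :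
    dirDeriv I V (fun y ↦ inner ℝ (W y) (φ y (W' y))) x =
      inner ℝ (covDeriv D V W x) (φ x (W' x)) + inner ℝ (W x) (φ x (covDeriv D V W' x)) := by
  have := hD.dEta_parallel V W W' hV hW hW' x
  rw [hM.dEta_eq _ _ (isVectorField_covDeriv hD.smooth hV hW) hW',
    hM.dEta_eq _ _ hW (isVectorField_covDeriv hD.smooth hV hW'),
    funext (hM.dEta_eq _ _ hW hW')] at this
  exact this

theorem covDeriv_eq (hD : IsBiLegendrianConnection I η ξ L Q D)
    (hM : IsContactMetric I n φ ξ η) {V W X Y : Π x : M, TangentSpace I x}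
    (hV : IsVectorField I V) (hW : IsVectorField I W) (hX : IsVectorField I X)
    (hY : IsVectorField I Y) (h : ∀ x, W x = X x + Y x + η x (W x) • ξ x) (x : M) :
    covDeriv D V W x = covDeriv D V X x + covDeriv D V Y x
      + dirDeriv I V (fun y ↦ η y (W y)) x • ξ x := by
  have hη := hM.contact.smooth.contMDiff_apply hW
  have e : W = (X + Y) + (fun y ↦ η y (W y)) • ξ := funext h
  conv_lhs => rw [e]
  rw [covDeriv_add V (hX.add hY) (IsVectorField.smul hη hM.reeb.smooth), covDeriv_add V hX hY,
    covDeriv_smul V hη hM.reeb.smooth, hD.reeb_parallel V hV, smul_zero, zero_add]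

/-- The contact form is parallel. -/
theorem eta_covDeriv (hD : IsBiLegendrianConnection I η ξ L Q D)
    (hM : IsContactMetric I n φ ξ η) (hS : IsSplitting φ ξ η L Q)
    {V W : Π x : M, TangentSpace I x} (hV : IsVectorField I V) (hW : IsVectorField I W) (x : M) :
    η x (covDeriv D V W x) = dirDeriv I V (fun y ↦ η y (W y)) x := by
  obtain ⟨X, Y, hX, hY, e⟩ := hS.exists_eq_add hW
  rw [hD.covDeriv_eq hM hV hW hX.smooth hY.smooth e]
  simp [hS.eta_left (hD.preserves₁ V X hV hX x), hS.eta_right (hD.preserves₂ V Y hV hY x),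
    hM.reeb.eta_reeb]

/-- `T(L, Q)` points along `ξ`. For `Z` in `Q` the component `Z_L` vanishes, so `T(Z, ξ)` reduces to
`[ξ, Z]_L`. -/
theorem inner_torsion_eq_zero (hD : IsBiLegendrianConnection I η ξ L Q D)
    (hM : IsContactMetric I n φ ξ η) (hS : IsSplitting φ ξ η L Q) {x : M}
    {v z q : TangentSpace I x} (hv : v ∈ withReeb ξ L x) (hz : z ∈ Q x) (hq : q ∈ Q x) :
    inner ℝ (D.torsion x v z) q = 0 := by
  obtain ⟨a, ha, c, hc, rfl⟩ := Submodule.mem_sup.1 hv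
  obtain ⟨t, rfl⟩ := Submodule.mem_span_singleton.1 hc
  obtain ⟨X, hX, rfl⟩ := hS.exists_isSection_eq ha
  obtain ⟨Z, hZ, rfl⟩ := hS.symm.exists_isSection_eq hz
  have hξ : inner ℝ (D.torsion x (ξ x) (Z x)) q = 0 := by
    rw [D.torsion_antisymm, hD.torsion_reeb Z hZ.smooth, hS.component_of_isSection_right hM hZ,
      mlieBracket_zero_right, inner_neg_left, inner_add_left, hS.symm.inner_component hM _ hq,
      hS.inner_eq_zero (hS.component_mem hM _ x) hq]
    simp
  rw [map_add, map_smul, add_apply, smul_apply,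
    hD.torsion_eq X Z hX hZ, inner_add_left, inner_smul_left, inner_smul_left, hξ,
    real_inner_comm, hM.inner_reeb, hS.eta_right hq]
  simp

/-- `(∇_V Z)_Q = [V, Z]_Q` for `V ∈ Γ(L ⊕ ℝξ)` and `Z ∈ Γ(Q)`. -/
theorem inner_covDeriv (hD : IsBiLegendrianConnection I η ξ L Q D)
    (hM : IsContactMetric I n φ ξ η) (hS : IsSplitting φ ξ η L Q)
    {V Z : Π x : M, TangentSpace I x} (hV : IsSection I (withReeb ξ L) V)
    (hZ : IsSection I Q Z) {x : M} {q : TangentSpace I x} (hq : q ∈ Q x) :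
    inner ℝ (covDeriv D V Z x) q = inner ℝ (mlieBracket I V Z x) q := by
  have h0 := hD.inner_torsion_eq_zero hM hS (hV.mem x) (hZ.mem x) hq
  -- The `Q`-part of `V` is orthogonal to itself, hence zero, so `∇_Z V` stays in `L ⊕ ℝξ`.
  have h1 : inner ℝ (covDeriv D Z V x) q = 0 := by
    obtain ⟨X, Y, hX, hY, e⟩ := hS.exists_eq_add hV.smooth
    have hY0 : Y = 0 := funext fun y ↦ (inner_self_eq_zero (𝕜 := ℝ)).1 <| by
      have := hS.symm.inner_withReeb_eq_zero hM (hY.mem y) (hV.mem y)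
      rwa [e y, inner_add_right, inner_add_right, inner_smul_right, hM.inner_reeb,
        hS.eta_right (hY.mem y), real_inner_comm, hS.inner_eq_zero (hX.mem y) (hY.mem y),
        mul_zero, zero_add, add_zero] at this
    subst hY0
    rw [hD.covDeriv_eq hM hZ.smooth hV.smooth hX.smooth hY.smooth e, inner_add_left,
      inner_add_left, inner_smul_left, hS.inner_eq_zero (hD.preserves₁ Z X hZ.smooth hX x) hq,
      real_inner_comm _ (ξ x), hM.inner_reeb, hS.eta_right hq]
    simp [covDeriv]
  rw [torsion_apply hV.smooth hZ.smooth, inner_sub_left, inner_sub_left, h1] at h0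
  linarith

theorem _root_.BiLegendrian.IsSection.withReeb {X : Π x : M, TangentSpace I x}
    (hX : IsSection I L X) (ξ : Π x : M, TangentSpace I x) : IsSection I (withReeb ξ L) X :=
  ⟨hX.smooth, fun x ↦ Submodule.mem_sup_left (hX.mem x)⟩

theorem _root_.BiLegendrian.IsContactMetric.isSection_reeb (hM : IsContactMetric I n φ ξ η)
    (L : Π x : M, Submodule ℝ (TangentSpace I x)) : IsSection I (withReeb ξ L) ξ :=
  ⟨hM.reeb.smooth, fun _ ↦ Submodule.mem_sup_right (Submodule.mem_span_singleton_self _)⟩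

/-! ### `∇ g = 0` and `∇ φ = 0` -/

/-- Subtract `∇ dη = 0` from `∇ g = 0` evaluated on `(U, φ W)`. -/
theorem isPhiParallel_of_isMetric (hD : IsBiLegendrianConnection I η ξ L Q D)
    (hM : IsContactMetric I n φ ξ η) (h : IsMetric I D) : IsPhiParallel I φ D := by
  intro V W hV hW x
  refine ext_inner_left ℝ fun u ↦ ?_
  obtain ⟨U, hU, rfl⟩ := exists_isVectorField_eq x u
  have h1 := h V U (app φ W) hV hU (hM.phi_smooth.isVectorField_app hW) x
  have h2 := hD.dirDeriv_inner_phi hM hV hU hW x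
  rw [inner_sub_right, inner_zero_right]
  change dirDeriv I V (fun y ↦ inner ℝ (U y) (φ y (W y))) x =
    inner ℝ _ (φ x (W x)) + inner ℝ (U x) (covDeriv D V (app φ W) x) at h1
  linarith

/-- `g(W, W') = η(W) η(W') - dη(W, φ W')` expresses `g` through the parallel tensors `η`, `dη` and
`φ`. -/
theorem isMetric_of_isPhiParallel (hD : IsBiLegendrianConnection I η ξ L Q D)
    (hM : IsContactMetric I n φ ξ η) (hS : IsSplitting φ ξ η L Q) (h : IsPhiParallel I φ D) :
    IsMetric I D := by
  intro V W W' hV hW hW' x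
  have hη := hM.contact.smooth.contMDiff_apply hW
  have hη' := hM.contact.smooth.contMDiff_apply hW'
  have e : (fun y ↦ inner ℝ (W y) (W' y)) =
      (fun y ↦ η y (W y)) * (fun y ↦ η y (W' y)) - fun y ↦ inner ℝ (W y) (φ y (app φ W' y)) := by
    funext y
    simp only [app, Pi.sub_apply, Pi.mul_apply, hM.phi_sq, inner_add_right, inner_neg_right,
      inner_smul_right, hM.inner_reeb]
    ring
  have hφW' := hM.phi_smooth.isVectorField_app hW'
  have d := hD.dirDeriv_inner_phi hM hV hW hφW' x
  have hd : ∀ {f : M → ℝ}, ContMDiff I 𝓘(ℝ) ∞ f → MDifferentiableAt I 𝓘(ℝ) f x :=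
    fun hf ↦ (hf x).mdifferentiableAt (by simp)
  have hsm : ContMDiff I 𝓘(ℝ) ∞ fun y ↦ inner ℝ (W y) (φ y (app φ W' y)) :=
    hW.contMDiff_inner (hM.phi_smooth.isVectorField_app hφW')
  have : dirDeriv I V (fun y ↦ inner ℝ (W y) (W' y)) x =
      η x (W x) * dirDeriv I V (fun y ↦ η y (W' y)) x
        + η x (W' x) * dirDeriv I V (fun y ↦ η y (W y)) x
        - dirDeriv I V (fun y ↦ inner ℝ (W y) (φ y (app φ W' y))) x := by
    rw [e]
    simp only [dirDeriv]
    rw [mvfderiv_sub ((hd hη).mul (hd hη')) (hd hsm), mvfderiv_mul (hd hη) (hd hη')]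
    rfl
  rw [this, d, sub_eq_zero.1 (h V W' hV hW' x), ← hD.eta_covDeriv hM hS hV hW,
    ← hD.eta_covDeriv hM hS hV hW', app, hM.phi_sq, hM.phi_sq, inner_add_right, inner_add_right,
    inner_neg_right, inner_neg_right, inner_smul_right, inner_smul_right, hM.inner_reeb,
    hM.inner_reeb]
  ring

/-! ### The bracket formulas -/

/-- `φ ∇_X X' = ∇_X (φ X') = [X, φ X']_Q`; then use that `φ` is isometric on `ker η`. -/
theorem hasBracketFormula_of_isPhiParallel (hD : IsBiLegendrianConnection I η ξ L Q D)
    (hM : IsContactMetric I n φ ξ η) (hS : IsSplitting φ ξ η L Q) (h : IsPhiParallel I φ D) :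
    HasBracketFormula I φ ξ L Q D := by
  intro X X' hX hX' x
  refine IsSplitting.eq_of_inner_eq (hD.preserves₁ X X' hX.smooth hX' x)
    (Submodule.neg_mem _ (hS.component_mem hM _ x)) fun q hq ↦ ?_
  have hq' := hS.phi_left hq
  have h1 := hD.inner_covDeriv hM hS (hX.withReeb ξ) (hS.isSection_app hM hX') hq'
  rw [sub_eq_zero.1 (h X X' hX.smooth hX'.smooth x), hM.inner_phi_phi, hS.eta_left hq, mul_zero,
    sub_zero] at h1
  rw [inner_neg_left, hS.inner_component hM _ hq, app, hM.inner_phi_left, neg_neg, h1]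

/-- The `Q`-component of `[ξ, φ X] - φ [ξ, X]` is `(∇_ξ φ) X`, and its `η`-component vanishes. -/
theorem hPreserves_of_isPhiParallel (hD : IsBiLegendrianConnection I η ξ L Q D)
    (hM : IsContactMetric I n φ ξ η) (hS : IsSplitting φ ξ η L Q) (h : IsPhiParallel I φ D) :
    HPreserves I φ ξ L := by
  intro X hX x
  refine Submodule.smul_mem _ _ (hS.mem_left ?_ fun q hq ↦ ?_)
  · rw [map_sub, hM.eta_phi, hS.symm.eta_reeb_bracket hM (hS.isSection_app hM hX), sub_zero]
  · rw [inner_sub_left, ← hD.inner_covDeriv hM hS (hM.isSection_reeb L) (hS.isSection_app hM hX) hq,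
      sub_eq_zero.1 (h ξ X hM.reeb.smooth hX.smooth x), hM.inner_phi_left, hM.inner_phi_left,
      hD.symm.inner_covDeriv hM hS.symm (hM.isSection_reeb Q) hX (hS.phi_right hq), sub_self]

/-- The bracket formulas determine `∇ φ` on sections of `L`. -/
theorem covDeriv_app_of_hasBracketFormula (hD : IsBiLegendrianConnection I η ξ L Q D)
    (hM : IsContactMetric I n φ ξ η) (hS : IsSplitting φ ξ η L Q)
    (hL : HasBracketFormula I φ ξ L Q D) (hQ : HasBracketFormula I φ ξ Q L D)
    (hh : HPreserves I φ ξ L) {V X : Π x : M, TangentSpace I x} (hV : IsVectorField I V)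
    (hX : IsSection I L X) (x : M) :
    covDeriv D V (app φ X) x = φ x (covDeriv D V X x) := by
  have hφX := hS.isSection_app hM hX
  have main : ∀ {W : Π x : M, TangentSpace I x}, IsVectorField I W →
      (∀ q ∈ Q x, inner ℝ (covDeriv D W (app φ X) x) q = -inner ℝ (covDeriv D W X x) (φ x q)) →
      covDeriv D W (app φ X) x = φ x (covDeriv D W X x) := fun {W} hW h ↦
    IsSplitting.eq_of_inner_eq (hD.preserves₂ W _ hW hφX x)
      (hS.phi_left (hD.preserves₁ W X hW hX x)) fun q hq ↦ by rw [h q hq, hM.inner_phi_left]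
  -- The derivative is tensorial in its direction: `L` is handled by the first formula, `Q` by the
  -- second, and `ξ` by `h`.
  obtain ⟨A, B, hA, hB, e⟩ := hS.exists_eq_add hV
  have h1 : covDeriv D A (app φ X) x = φ x (covDeriv D A X x) := by
    refine main hA.smooth fun q hq ↦ ?_
    rw [hL A X hA hX, inner_neg_left, hS.inner_component hM _ (hS.phi_right hq), app,
      hM.inner_phi_phi, hS.eta_right hq, mul_zero, sub_zero, neg_neg,
      hD.inner_covDeriv hM hS (hA.withReeb ξ) hφX hq]
  -- The formula on `Q`, applied to `φ X`, involves only `[B, X]` because `φ² X = -X`.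
  have h2 : covDeriv D B (app φ X) x = φ x (covDeriv D B X x) := by
    refine main hB.smooth fun q hq ↦ ?_
    have hXX : app φ (app φ X) = -X := funext fun y ↦
      hM.phi_phi_of_eta_eq_zero (hS.eta_left (hX.mem y))
    have hneg : mlieBracket I B (-X) x = -mlieBracket I B X x := by
      have := mlieBracket_const_smul_right (I := I) (V := B) (c := (-1 : ℝ))
        (hX.smooth.mdifferentiableAt x)
      simpa using this
    rw [hQ B _ hB hφX, hXX, inner_neg_left, hS.symm.inner_component hM _ hq, app, hneg,
      hM.inner_phi_left, inner_neg_left, neg_neg,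
      hD.symm.inner_covDeriv hM hS.symm (hB.withReeb ξ) hX (hS.phi_right hq)]
  have h3 : covDeriv D ξ (app φ X) x = φ x (covDeriv D ξ X x) := by
    refine main hM.reeb.smooth fun q hq ↦ ?_
    have := hS.inner_eq_zero (hh X hX x) hq
    rw [hField, inner_smul_left, inner_sub_left, hM.inner_phi_left] at this
    rw [hD.inner_covDeriv hM hS (hM.isSection_reeb L) hφX hq,
      hD.symm.inner_covDeriv hM hS.symm (hM.isSection_reeb Q) hX (hS.phi_right hq)]
    simp at this
    linarith
  simp only [covDeriv] at h1 h2 h3 ⊢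
  rw [e x]
  simp only [map_add, map_smul, h1, h2, h3]

theorem isPhiParallel_of_hasBracketFormula (hD : IsBiLegendrianConnection I η ξ L Q D)
    (hM : IsContactMetric I n φ ξ η) (hS : IsSplitting φ ξ η L Q)
    (hL : HasBracketFormula I φ ξ L Q D) (hQ : HasBracketFormula I φ ξ Q L D)
    (hhL : HPreserves I φ ξ L) (hhQ : HPreserves I φ ξ Q) : IsPhiParallel I φ D := by
  intro V W hV hW x
  obtain ⟨X, Y, hX, hY, e⟩ := hS.exists_eq_add hW
  have eφ : app φ W = app φ X + app φ Y := by
    funext y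
    simp only [app, Pi.add_apply]
    rw [e y]
    simp [hM.phi_reeb]
  rw [hD.covDeriv_eq hM hV hW hX.smooth hY.smooth e, eφ,
    covDeriv_add V (hS.isSection_app hM hX).smooth (hS.symm.isSection_app hM hY).smooth,
    hD.covDeriv_app_of_hasBracketFormula hM hS hL hQ hhL hV hX,
    hD.symm.covDeriv_app_of_hasBracketFormula hM hS.symm hQ hL hhQ hV hY]
  simp [hM.phi_reeb]

/-! ### Bundle-like metrics -/

/-- Only `Q`-components of `[V, Z]` and `[V, Z']` enter, and these agree with those of `∇_V Z` and
`∇_V Z'`. -/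
theorem lieMetric_eq (hD : IsBiLegendrianConnection I η ξ L Q D)
    (hM : IsContactMetric I n φ ξ η) (hS : IsSplitting φ ξ η L Q)
    {V Z Z' : Π x : M, TangentSpace I x} (hV : IsSection I (withReeb ξ L) V)
    (hZ : IsSection I Q Z) (hZ' : IsSection I Q Z') (x : M) :
    lieMetric I V Z Z' x = D.derivMetricTensor x (Z x) (Z' x) (V x) := by
  rw [derivMetricTensor_apply V hZ.smooth hZ'.smooth, lieMetric,
    hD.inner_covDeriv hM hS hV hZ (hZ'.mem x), real_inner_comm (covDeriv D V Z' x),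
    hD.inner_covDeriv hM hS hV hZ' (hZ.mem x), real_inner_comm (Z x)]

theorem isBundleLike_of_isMetric (hD : IsBiLegendrianConnection I η ξ L Q D)
    (hM : IsContactMetric I n φ ξ η) (hS : IsSplitting φ ξ η L Q) (h : IsMetric I D) :
    IsBundleLike I (withReeb ξ L) := by
  intro V Z Z' hV hZ hZ' x
  rw [hS.isNormalField_withReeb_iff hM] at hZ hZ'
  rw [hD.lieMetric_eq hM hS hV hZ hZ', isMetric_iff.1 h]

theorem derivMetricTensor_of_isBundleLike (hD : IsBiLegendrianConnection I η ξ L Q D)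
    (hM : IsContactMetric I n φ ξ η) (hS : IsSplitting φ ξ η L Q)
    (h : IsBundleLike I (withReeb ξ L)) {x : M} {v w w' : TangentSpace I x}
    (hv : v ∈ withReeb ξ L x) (hw : w ∈ Q x) (hw' : w' ∈ Q x) :
    D.derivMetricTensor x w w' v = 0 := by
  obtain ⟨Z, hZ, rfl⟩ := hS.symm.exists_isSection_eq hw
  obtain ⟨Z', hZ', rfl⟩ := hS.symm.exists_isSection_eq hw'
  have key : ∀ V, IsSection I (withReeb ξ L) V → D.derivMetricTensor x (Z x) (Z' x) (V x) = 0 :=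
    fun V hV ↦ by
      rw [← hD.lieMetric_eq hM hS hV hZ hZ']
      exact h V Z Z' hV ((hS.isNormalField_withReeb_iff hM).2 hZ)
        ((hS.isNormalField_withReeb_iff hM).2 hZ') x
  obtain ⟨a, ha, c, hc, rfl⟩ := Submodule.mem_sup.1 hv
  obtain ⟨t, rfl⟩ := Submodule.mem_span_singleton.1 hc
  obtain ⟨X, hX, rfl⟩ := hS.exists_isSection_eq ha
  rw [map_add, map_smul, key X (hX.withReeb ξ), key ξ (hM.isSection_reeb L)]
  simp

/-- `∇ dη = 0` relates the restrictions of `∇ g` to `L` and to `Q`. -/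
theorem derivMetricTensor_phi_phi (hD : IsBiLegendrianConnection I η ξ L Q D)
    (hM : IsContactMetric I n φ ξ η) (hS : IsSplitting φ ξ η L Q) {x : M}
    (v : TangentSpace I x) {w w' : TangentSpace I x} (hw : w ∈ L x) (hw' : w' ∈ L x) :
    D.derivMetricTensor x (φ x w) (φ x w') v = -D.derivMetricTensor x w w' v := by
  obtain ⟨V, hV, rfl⟩ := exists_isVectorField_eq x v
  obtain ⟨X, hX, rfl⟩ := hS.exists_isSection_eq hw
  obtain ⟨X', hX', rfl⟩ := hS.exists_isSection_eq hw'
  -- This is `∇ dη = 0` on the pair `(φ X', X)`. Adding it to its copy with `X` and `X'` exchanged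
  -- gives all four covariant derivative terms of the two values of `∇ g`.
  have half : ∀ {X X' : Π x : M, TangentSpace I x}, IsSection I L X → IsSection I L X' →
      dirDeriv I V (fun y ↦ inner ℝ (X y) (X' y)) x =
        inner ℝ (covDeriv D V X x) (X' x)
          + inner ℝ (φ x (X x)) (covDeriv D V (app φ X') x) := by
    intro X X' hX hX'
    have d := hD.dirDeriv_inner_phi hM hV (hS.isSection_app hM hX').smooth hX.smooth x
    have e : (fun y ↦ inner ℝ (app φ X' y) (φ y (X y))) = fun y ↦ inner ℝ (X y) (X' y) := by
      funext y
      rw [app, hM.inner_phi_phi, hS.eta_left (hX.mem y), mul_zero, sub_zero, real_inner_comm]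
    rw [e] at d
    rw [d, app, hM.inner_phi_phi, hS.eta_left (hX'.mem x), zero_mul, sub_zero,
      real_inner_comm (X' x), real_inner_comm (φ x (X x))]
    ring
  have e1 := derivMetricTensor_apply (D := D) V hX.smooth hX'.smooth x
  have e2 := derivMetricTensor_apply (D := D) V (hS.isSection_app hM hX).smooth
    (hS.isSection_app hM hX').smooth x
  have e3 : (fun y ↦ inner ℝ (app φ X y) (app φ X' y)) = fun y ↦ inner ℝ (X y) (X' y) := by
    funext y
    rw [app, app, hM.inner_phi_phi, hS.eta_left (hX.mem y), zero_mul, sub_zero]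
  have e4 : (fun y ↦ inner ℝ (X' y) (X y)) = fun y ↦ inner ℝ (X y) (X' y) :=
    funext fun y ↦ real_inner_comm _ _
  have f1 := half hX hX'
  have f2 := half hX' hX
  rw [e4, real_inner_comm (X x), real_inner_comm _ (φ x (X' x))] at f2
  rw [e3] at e2
  simp only [app] at e2 f1 f2
  linarith

theorem derivMetricTensor_mixed (hD : IsBiLegendrianConnection I η ξ L Q D)
    (hS : IsSplitting φ ξ η L Q) {x : M} (v : TangentSpace I x) {w w' : TangentSpace I x}
    (hw : w ∈ L x) (hw' : w' ∈ Q x) : D.derivMetricTensor x w w' v = 0 := by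
  obtain ⟨V, hV, rfl⟩ := exists_isVectorField_eq x v
  obtain ⟨X, hX, rfl⟩ := hS.exists_isSection_eq hw
  obtain ⟨Y, hY, rfl⟩ := hS.symm.exists_isSection_eq hw'
  rw [derivMetricTensor_apply V hX.smooth hY.smooth,
    dirDeriv_eq_zero_of_const fun y ↦ hS.inner_eq_zero (hX.mem y) (hY.mem y),
    hS.inner_eq_zero (hD.preserves₁ V X hV hX x) (hY.mem x),
    hS.inner_eq_zero (hX.mem x) (hD.preserves₂ V Y hV hY x)]
  ring

theorem derivMetricTensor_reeb_right (hD : IsBiLegendrianConnection I η ξ L Q D)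
    (hM : IsContactMetric I n φ ξ η) (hS : IsSplitting φ ξ η L Q) {x : M}
    (v w : TangentSpace I x) : D.derivMetricTensor x w (ξ x) v = 0 := by
  obtain ⟨V, hV, rfl⟩ := exists_isVectorField_eq x v
  obtain ⟨W, hW, rfl⟩ := exists_isVectorField_eq x w
  rw [derivMetricTensor_apply V hW hM.reeb.smooth, hD.reeb_parallel V hV, hM.inner_reeb,
    hD.eta_covDeriv hM hS hV hW, funext fun y ↦ hM.inner_reeb y (W y), inner_zero_right]
  ring

theorem derivMetricTensor_reeb_left (hD : IsBiLegendrianConnection I η ξ L Q D)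
    (hM : IsContactMetric I n φ ξ η) (hS : IsSplitting φ ξ η L Q) {x : M}
    (v w : TangentSpace I x) : D.derivMetricTensor x (ξ x) w v = 0 := by
  obtain ⟨V, hV, rfl⟩ := exists_isVectorField_eq x v
  obtain ⟨W, hW, rfl⟩ := exists_isVectorField_eq x w
  rw [derivMetricTensor_apply V hM.reeb.smooth hW, hD.reeb_parallel V hV,
    real_inner_comm _ (ξ x), hM.inner_reeb, hD.eta_covDeriv hM hS hV hW,
    funext fun y ↦ (real_inner_comm (W y) (ξ y)).trans (hM.inner_reeb y (W y)), inner_zero_left]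
  ring

/-- Directions in `L ⊕ ℝξ` are covered by `hL`. For directions in `Q`, `φ` moves both arguments to
`L`, where `hQ` applies. -/
theorem derivMetricTensor_right_right (hD : IsBiLegendrianConnection I η ξ L Q D)
    (hM : IsContactMetric I n φ ξ η) (hS : IsSplitting φ ξ η L Q)
    (hL : IsBundleLike I (withReeb ξ L)) (hQ : IsBundleLike I (withReeb ξ Q)) {x : M}
    (v : TangentSpace I x) {w w' : TangentSpace I x} (hw : w ∈ Q x) (hw' : w' ∈ Q x) :
    D.derivMetricTensor x w w' v = 0 := by
  obtain ⟨a, ha, b, hb, e⟩ := hS.exists_mem_eq_add v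
  have h1 := hD.derivMetricTensor_of_isBundleLike hM hS hL (v := a + η x v • ξ x)
    (Submodule.add_mem_sup ha (Submodule.smul_mem _ _ (Submodule.mem_span_singleton_self _)))
    hw hw'
  have h2 := hD.symm.derivMetricTensor_of_isBundleLike hM hS.symm hQ (v := b)
    (Submodule.mem_sup_left hb) (hS.phi_right hw) (hS.phi_right hw')
  rw [hD.symm.derivMetricTensor_phi_phi hM hS.symm b hw hw', neg_eq_zero] at h2
  rw [e, add_right_comm, map_add, h1, h2, add_zero]

theorem isMetric_of_isBundleLike (hD : IsBiLegendrianConnection I η ξ L Q D)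
    (hM : IsContactMetric I n φ ξ η) (hS : IsSplitting φ ξ η L Q)
    (hL : IsBundleLike I (withReeb ξ L)) (hQ : IsBundleLike I (withReeb ξ Q)) :
    IsMetric I D := by
  rw [isMetric_iff]
  intro x v w w'
  obtain ⟨a, ha, b, hb, e⟩ := hS.exists_mem_eq_add w
  obtain ⟨a', ha', b', hb', e'⟩ := hS.exists_mem_eq_add w'
  have add_left : ∀ u u' z : TangentSpace I x, D.derivMetricTensor x (u + u') z v =
      D.derivMetricTensor x u z v + D.derivMetricTensor x u' z v := fun u u' z ↦
    congrArg (fun T ↦ T z v) (ContinuousLinearMap.map_add (D.derivMetricTensor x) u u')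
  have smul_left : ∀ (c : ℝ) (u z : TangentSpace I x), D.derivMetricTensor x (c • u) z v =
      c • D.derivMetricTensor x u z v := fun c u z ↦
    congrArg (fun T ↦ T z v) (ContinuousLinearMap.map_smul (D.derivMetricTensor x) c u)
  have add_right : ∀ u z z' : TangentSpace I x, D.derivMetricTensor x u (z + z') v =
      D.derivMetricTensor x u z v + D.derivMetricTensor x u z' v := fun u z z' ↦ by
    rw [map_add]; rfl
  have smul_right : ∀ (c : ℝ) (u z : TangentSpace I x), D.derivMetricTensor x u (c • z) v =
      c • D.derivMetricTensor x u z v := fun c u z ↦ by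
    rw [map_smul]; rfl
  -- Of the nine blocks of `∇ g`, five involve `ξ`, two are mixed and two are diagonal.
  rw [e, e']
  simp only [add_left, smul_left, add_right, smul_right,
    hD.derivMetricTensor_reeb_right hM hS, hD.derivMetricTensor_reeb_left hM hS,
    hD.derivMetricTensor_mixed hS v ha hb', hD.symm.derivMetricTensor_mixed hS.symm v hb ha',
    hD.derivMetricTensor_right_right hM hS hL hQ v hb hb',
    hD.symm.derivMetricTensor_right_right hM hS.symm hQ hL v ha ha', smul_zero, add_zero]

/-! ### Totally geodesic foliations -/

/-- Koszul's formula for the second fundamental form of an integrable distribution. -/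
theorem lieMetric_eq_neg_two_mul {D' : CovariantDerivative I E (TangentSpace I : M → Type _)}
    (hD' : IsLeviCivita I D') (hM : IsContactMetric I n φ ξ η) (hS : IsSplitting φ ξ η L Q)
    (hL : IsIntegrable I L) {V Z Z' : Π x : M, TangentSpace I x}
    (hV : IsSection I (withReeb ξ Q) V) (hZ : IsSection I L Z) (hZ' : IsSection I L Z') (x : M) :
    lieMetric I V Z Z' x = -2 * inner ℝ (covDeriv D' Z Z' x) (V x) := by
  have br : ∀ {V W : Π x : M, TangentSpace I x}, IsVectorField I V → IsVectorField I W →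
      mlieBracket I V W x = covDeriv D' V W x - covDeriv D' W V x := by
    intro V W hV hW
    have := torsion_apply (D := D') hV hW x
    rw [hD'.2] at this
    exact (sub_eq_zero.1 this.symm).symm
  have orth : ∀ {X : Π x : M, TangentSpace I x}, IsSection I L X → ∀ y,
      inner ℝ (X y) (V y) = 0 := fun hX y ↦ hS.inner_withReeb_eq_zero hM (hX.mem y) (hV.mem y)
  -- The torsion-free metric connection gives `(𝓛_V g)(Z, Z') = g(∇_Z V, Z') + g(Z, ∇_{Z'} V)`.
  -- Since `Z, Z' ⊥ V`, this is `-g(V, ∇_Z Z' + ∇_{Z'} Z)`, and integrability makes the two terms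
  -- equal.
  have m1 := hD'.1 V Z Z' hV.smooth hZ.smooth hZ'.smooth x
  have m2 := hD'.1 Z Z' V hZ.smooth hZ'.smooth hV.smooth x
  have m3 := hD'.1 Z' Z V hZ'.smooth hZ.smooth hV.smooth x
  rw [dirDeriv_eq_zero_of_const (orth hZ')] at m2
  rw [dirDeriv_eq_zero_of_const (orth hZ)] at m3
  have b := hS.inner_withReeb_eq_zero hM (hL Z Z' hZ hZ' x) (hV.mem x)
  rw [br hZ.smooth hZ'.smooth, inner_sub_left] at b
  rw [lieMetric, br hV.smooth hZ.smooth, br hV.smooth hZ'.smooth, inner_sub_left, inner_sub_right,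
    real_inner_comm (Z' x) (covDeriv D' Z V x)]
  linarith

/-- The second fundamental form of `L` is tested on normals, that is on `Q ⊕ ℝξ`; hence the
distribution on the right is the complementary one. -/
theorem isTotallyGeodesic_iff {D' : CovariantDerivative I E (TangentSpace I : M → Type _)}
    (hD' : IsLeviCivita I D') (hM : IsContactMetric I n φ ξ η) (hS : IsSplitting φ ξ η L Q)
    (hL : IsIntegrable I L) :
    IsTotallyGeodesic I D' L ↔ IsBundleLike I (withReeb ξ Q) := by
  constructor
  · intro h V Z Z' hV hZ hZ' x
    rw [hS.symm.isNormalField_withReeb_iff hM] at hZ hZ'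
    rw [lieMetric_eq_neg_two_mul hD' hM hS hL hV hZ hZ',
      hS.inner_withReeb_eq_zero hM (h Z Z' hZ hZ' x) (hV.mem x), mul_zero]
  · intro h X X' hX hX' x
    have key : ∀ V, IsSection I (withReeb ξ Q) V → inner ℝ (covDeriv D' X X' x) (V x) = 0 :=
      fun V hV ↦ by
        have := lieMetric_eq_neg_two_mul hD' hM hS hL hV hX hX' x
        rw [h V X X' hV ((hS.symm.isNormalField_withReeb_iff hM).2 hX)
          ((hS.symm.isNormalField_withReeb_iff hM).2 hX')] at this
        linarith
    refine hS.mem_left ?_ fun q hq ↦ ?_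
    · rw [← hM.inner_reeb, key ξ (hM.isSection_reeb Q)]
    · obtain ⟨Y, hY, rfl⟩ := hS.symm.exists_isSection_eq hq
      exact key Y (hY.withReeb ξ)

end IsBiLegendrianConnection

end Connection

end BiLegendrian

/-! ### The equivalences -/

open BiLegendrian in
theorem proposition2p4 {n : ℕ} {M : Type*} [TopologicalSpace M] [T2Space M]
    [SecondCountableTopology M] [ConnectedSpace M]
    [ChartedSpace (EuclideanSpace ℝ (Fin (2 * n + 1))) M]
    [IsManifold (𝓡 (2 * n + 1)) ∞ M]
    [RiemannianBundle (fun x : M ↦ TangentSpace (𝓡 (2 * n + 1)) x)]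
    [IsContMDiffRiemannianBundle (𝓡 (2 * n + 1)) ∞ (EuclideanSpace ℝ (Fin (2 * n + 1)))
      (fun x : M ↦ TangentSpace (𝓡 (2 * n + 1)) x)]
    (φ : Π x : M, TangentSpace (𝓡 (2 * n + 1)) x →L[ℝ] TangentSpace (𝓡 (2 * n + 1)) x)
    (ξ : Π x : M, TangentSpace (𝓡 (2 * n + 1)) x)
    (η : Π x : M, TangentSpace (𝓡 (2 * n + 1)) x →L[ℝ] ℝ)
    (hM : IsContactMetric (𝓡 (2 * n + 1)) n φ ξ η)
    (L Q : Π x : M, Submodule ℝ (TangentSpace (𝓡 (2 * n + 1)) x))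
    (hL : IsLegendrian (𝓡 (2 * n + 1)) n η L)
    (hQ : Q = conj φ L)
    (D : CovariantDerivative (𝓡 (2 * n + 1)) (EuclideanSpace ℝ (Fin (2 * n + 1)))
      (TangentSpace (𝓡 (2 * n + 1)) : M → Type _))
    (hD : IsBiLegendrianConnection (𝓡 (2 * n + 1)) η ξ L Q D) :
    [IsMetric (𝓡 (2 * n + 1)) D,
      IsPhiParallel (𝓡 (2 * n + 1)) φ D,
      HasBracketFormula (𝓡 (2 * n + 1)) φ ξ L Q D ∧
        HasBracketFormula (𝓡 (2 * n + 1)) φ ξ Q L D ∧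
        HPreserves (𝓡 (2 * n + 1)) φ ξ L ∧ HPreserves (𝓡 (2 * n + 1)) φ ξ Q,
      IsBundleLike (𝓡 (2 * n + 1)) (withReeb ξ L) ∧
        IsBundleLike (𝓡 (2 * n + 1)) (withReeb ξ Q)].TFAE ∧
    (IsIntegrable (𝓡 (2 * n + 1)) L → IsIntegrable (𝓡 (2 * n + 1)) Q →
      ∀ D' : CovariantDerivative (𝓡 (2 * n + 1)) (EuclideanSpace ℝ (Fin (2 * n + 1)))
          (TangentSpace (𝓡 (2 * n + 1)) : M → Type _),
        IsLeviCivita (𝓡 (2 * n + 1)) D' →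
        (IsMetric (𝓡 (2 * n + 1)) D ↔
          IsTotallyGeodesic (𝓡 (2 * n + 1)) D' L ∧ IsTotallyGeodesic (𝓡 (2 * n + 1)) D' Q)) := by
  subst hQ
  have hS := hM.isSplitting hL
  refine ⟨?_, fun hL' hQ' D' hD' ↦ ?_⟩
  · tfae_have 1 → 2 := hD.isPhiParallel_of_isMetric hM
    tfae_have 2 → 1 := hD.isMetric_of_isPhiParallel hM hS
    tfae_have 2 → 3 := fun h ↦ ⟨hD.hasBracketFormula_of_isPhiParallel hM hS h,
      hD.symm.hasBracketFormula_of_isPhiParallel hM hS.symm h,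
      hD.hPreserves_of_isPhiParallel hM hS h, hD.symm.hPreserves_of_isPhiParallel hM hS.symm h⟩
    tfae_have 3 → 2 := fun h ↦
      hD.isPhiParallel_of_hasBracketFormula hM hS h.1 h.2.1 h.2.2.1 h.2.2.2
    tfae_have 1 → 4 := fun h ↦ ⟨hD.isBundleLike_of_isMetric hM hS h,
      hD.symm.isBundleLike_of_isMetric hM hS.symm h⟩
    tfae_have 4 → 1 := fun h ↦ hD.isMetric_of_isBundleLike hM hS h.1 h.2
    tfae_finish
  · rw [IsBiLegendrianConnection.isTotallyGeodesic_iff hD' hM hS hL',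
      IsBiLegendrianConnection.isTotallyGeodesic_iff hD' hM hS.symm hQ']
    -- The order is swapped: `L` totally geodesic corresponds to the metric being bundle-like for `Q
    -- ⊕ ℝξ`.
    exact ⟨fun h ↦ ⟨hD.symm.isBundleLike_of_isMetric hM hS.symm h,
      hD.isBundleLike_of_isMetric hM hS h⟩, fun h ↦ hD.isMetric_of_isBundleLike hM hS h.2 h.1⟩
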